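/- Let $p$ be an odd prime, and let $\left(\frac{\cdot}{p}\right)$ denote the Legendre symbol. (1) If $p \equiv \pm 1 \pmod 8$, then \[ \sum_{a=1}^{(p-1)/2} \left(\frac{a}{p}\right)(-1)^a > 0 . \] (2) If $p \equiv \pm 5 \pmod 8$, then \[ \sum_{a=1}^{(p-1)/2} \left(\frac{a}{p}\right)(-1)^a < 0 . \] Equivalently, both statements are summarized by the single inequality \[ \left(\frac{2}{p}\right)\sum_{a=1}^{(p-1)/2} \left(\frac{a}{p}\right)(-1)^a > 0 . \] -/

import Mathlib

/-! ### Sign of the quadratic Gauss sum, by reduction modulo p. -/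

section GaussSumSign

open Polynomial

/-! Doubling permutes 1, …, (p-1)/2 modulo p up to sign: a < p/4 goes to the even number 2a, any
other a to the odd number p - 2a (`sum_legendreSym_mul_neg_one_pow`). After the factor (2/p) is
removed, what remains is the sum of (a/p) over a < p/2 if p ≡ 3 mod 4, and the sum over a < p/4
minus the sum over p/4 < a < p/2 if p ≡ 1 mod 4. Each is a positive multiple of L(1, ψ) for a real
odd character ψ, namely (·/p) times the principal character mod 2, respectively times χ₄; and L(1,
ψ) > 0 (`LFunction_one_pos`).

To see the proportionality, write e(x) = exp(2πix). The Gauss sum τ expands ψ(n) into finitely many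
exponentials e(n x_k). Since Im ∑ e(nx)/n = π(1/2 - x) on (0, 1) (`expZeta_one_im`), L(1, ψ) becomes
a finite sum of fractional parts (`sum_mul_half_sub_fract_pos`), and pairing a with p - a folds it
to the half range.

The sign of the constant is essential, so τ² does not suffice: Gauss's evaluation τ = √p or i√p is
needed (`gaussSum_legendreChar`). It compares τ with an explicit product of sines; the ambiguous
sign is fixed modulo p (`eq_neg_one_pow_of_sum_quadraticChar_eq`). -/

/-- If `θ = X * d/dX`, then `θ^k ((X - 1)^k * h)` takes the value `k! * h(1)` at `1`. -/
theorem eval_one_iterate_X_mul_derivative_X_sub_one_pow_mul {R : Type*} [CommRing R] (k : ℕ)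
    (h : R[X]) :
    ((fun f : R[X] => X * derivative f)^[k] ((X - 1) ^ k * h)).eval 1 =
      (k.factorial : R) * h.eval 1 := by
  induction k generalizing h with
  | zero => simp
  | succ k ih =>
    have key : X * derivative ((X - 1) ^ (k + 1) * h) =
        (X - 1) ^ k * (((k + 1 : ℕ) : R[X]) * X * h + (X - 1) * X * derivative h) := by
      have : derivative (X - 1 : R[X]) = 1 := by simp
      rw [derivative_mul, derivative_pow, this, Nat.add_sub_cancel, map_natCast]
      ring
    rw [Function.iterate_succ_apply, key, ih, Nat.factorial_succ]
    simp
    ring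

theorem iterate_X_mul_derivative_sum {R ι : Type*} [CommRing R] (k : ℕ) (s : Finset ι)
    (c : ι → R) (e : ι → ℕ) :
    (fun f : R[X] => X * derivative f)^[k] (∑ i ∈ s, C (c i) * X ^ e i) =
      ∑ i ∈ s, C (c i * (e i : R) ^ k) * X ^ e i := by
  induction k generalizing c with
  | zero => simp
  | succ k ih =>
    have key : X * derivative (∑ i ∈ s, C (c i) * X ^ e i) =
        ∑ i ∈ s, C (c i * (e i : R)) * X ^ e i := by
      rw [derivative_sum, Finset.mul_sum]
      refine Finset.sum_congr rfl fun i _ => ?_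
      rcases Nat.eq_zero_or_pos (e i) with h0 | h0
      · simp [h0]
      · obtain ⟨t, ht⟩ := Nat.exists_eq_add_of_lt h0
        rw [derivative_C_mul_X_pow, ht]
        simp only [zero_add, Nat.add_sub_cancel, pow_succ]
        ring
    rw [Function.iterate_succ_apply, key, ih]
    refine Finset.sum_congr rfl fun i _ => ?_
    rw [pow_succ]
    ring_nf

/-- The half-product `∏_{k=1}^{m} X^{km} (X^k - 1)`. -/
noncomputable def halfProduct (R : Type*) [CommRing R] (m : ℕ) : R[X] :=
  ∏ k ∈ Finset.range m, X ^ ((k + 1) * m) * (X ^ (k + 1) - 1)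

theorem halfProduct_eq (R : Type*) [CommRing R] (m : ℕ) :
    ∃ h : R[X], halfProduct R m = (X - 1) ^ m * h ∧ h.eval 1 = (m.factorial : R) := by
  refine ⟨∏ k ∈ Finset.range m, X ^ ((k + 1) * m) * ∑ i ∈ Finset.range (k + 1), X ^ i, ?_, ?_⟩
  · have : (X - 1 : R[X]) ^ m = ∏ k ∈ Finset.range m, (X - 1) := by simp
    rw [halfProduct, this, ← Finset.prod_mul_distrib]
    refine Finset.prod_congr rfl fun k _ => ?_
    rw [← geom_sum_mul]
    ring
  · rw [eval_prod, ← Finset.prod_range_add_one_eq_factorial, Nat.cast_prod]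
    refine Finset.prod_congr rfl fun k _ => ?_
    simp [eval_finsetSum]

/-- Wilson's theorem, with factors moved across by p - 1 - k ≡ -(k + 1). At k = (p-1)/2 it gives the
square of ((p-1)/2)! modulo p. -/
theorem factorial_mul_factorial_sub {p : ℕ} [Fact p.Prime] (k : ℕ) (hk : k + 1 ≤ p) :
    (((p - 1 - k).factorial * k.factorial : ℕ) : ZMod p) = (-1) ^ (k + 1) := by
  induction k with
  | zero => simp
  | succ k ih =>
    have h1 : p - 1 - k = (p - 1 - (k + 1)) + 1 := by omega
    have h2 : ((p - 1 - (k + 1) + 1 : ℕ) : ZMod p) = -((k + 1 : ℕ) : ZMod p) := by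
      rw [eq_neg_iff_add_eq_zero, ← Nat.cast_add,
        show p - 1 - (k + 1) + 1 + (k + 1) = p by omega, ZMod.natCast_self]
    have h3 := ih (by omega)
    rw [h1, Nat.factorial_succ, Nat.cast_mul, Nat.cast_mul, h2] at h3
    rw [Nat.factorial_succ, pow_succ, ← h3]
    push_cast
    ring

/-- Modulo p the cyclotomic polynomial is (X - 1)^(p-1), so the relation at ζ becomes a congruence
of polynomials to high order at 1. Applying (X d/dX)^m with m = p/2 and evaluating at 1 gives -1 = ε
(m!)², and Wilson's theorem yields ε. -/
theorem eq_neg_one_pow_of_sum_quadraticChar_eq {p : ℕ} [Fact p.Prime] (hp : p ≠ 2) {ζ : ℂ}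
    (hζ : IsPrimitiveRoot ζ p) {ε : ℤ} (hε : ε = 1 ∨ ε = -1)
    (h : ∑ x : ZMod p, (quadraticChar (ZMod p) x : ℂ) * ζ ^ x.val =
      ε * ∏ k ∈ Finset.range (p / 2), ζ ^ ((k + 1) * (p / 2)) * (ζ ^ (k + 1) - 1)) :
    ε = (-1) ^ (p / 2) := by
  have hpp : p.Prime := Fact.out
  have hodd : p % 2 = 1 := (hpp.eq_two_or_odd).resolve_left hp
  set m := p / 2 with hm
  have hpm : p = 2 * m + 1 := by omega
  let Q (R : Type) [CommRing R] : R[X] :=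
    ∑ x : ZMod p, C ((quadraticChar (ZMod p) x : ℤ) : R) * X ^ x.val
  have hdvd : cyclotomic p ℤ ∣ Q ℤ - C ε * halfProduct ℤ m := by
    rw [cyclotomic_eq_minpoly hζ hpp.pos]
    refine minpoly.isIntegrallyClosed_dvd (hζ.isIntegral hpp.pos) ?_
    simpa [Q, halfProduct, map_prod, sub_eq_zero] using h
  have hdvd' : (X - 1 : (ZMod p)[X]) ^ (p - 1) ∣
      Q (ZMod p) - C (ε : ZMod p) * halfProduct (ZMod p) m := by
    have h1 := Polynomial.map_dvd (Int.castRingHom (ZMod p)) hdvd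
    have h2 := cyclotomic_mul_prime_eq_pow_of_not_dvd (ZMod p) (p := p) (n := 1)
      (by simpa using hpp.one_lt.ne')
    rw [one_mul, cyclotomic_one] at h2
    rw [map_cyclotomic, h2] at h1
    convert! h1 using 1
    simp [Q, halfProduct, Polynomial.map_sum, Polynomial.map_prod]
  obtain ⟨g, hg⟩ := hdvd'
  obtain ⟨r, hr, hr1⟩ := halfProduct_eq (ZMod p) m
  have hQ : Q (ZMod p) = (X - 1) ^ m * ((X - 1) ^ m * g + C (ε : ZMod p) * r) := by
    have e : p - 1 = m + m := by omega
    rw [sub_eq_iff_eq_add] at hg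
    rw [hg, hr, e, pow_add]
    ring
  have h1 := eval_one_iterate_X_mul_derivative_X_sub_one_pow_mul m
    ((X - 1) ^ m * g + C (ε : ZMod p) * r)
  rw [← hQ, iterate_X_mul_derivative_sum] at h1
  have hm0 : m ≠ 0 := by have := hpp.two_le; omega
  -- Euler's criterion: (x/p) ≡ x^m, so each term of the differentiated sum is x^(2m).
  have h2 : ∀ x : ZMod p, ((quadraticChar (ZMod p) x : ℤ) : ZMod p) * ((x.val : ℕ) : ZMod p) ^ m =
      x ^ (p - 1) := by
    intro x
    have := legendreSym.eq_pow p (x.val : ℤ)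
    simp only [legendreSym, Int.cast_natCast, ZMod.natCast_zmod_val] at this
    rw [this, ZMod.natCast_zmod_val, ← pow_add]
    congr 1
    omega
  have h3 : ∑ x : ZMod p, x ^ (p - 1) = -1 := by
    have h4 : ∀ x : ZMod p, x ^ (p - 1) = 1 - (if x = 0 then 1 else 0) := by
      intro x
      split_ifs with hx
      · rw [hx, zero_pow (by omega)]; simp
      · rw [ZMod.pow_card_sub_one_eq_one hx, sub_zero]
    simp [h4]
  rw [eval_finsetSum] at h1
  simp only [eval_mul, eval_C, eval_pow, eval_X, one_pow, mul_one, h2, h3, eval_add, eval_sub,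
    eval_one, sub_self, zero_pow hm0, zero_mul, zero_add, hr1] at h1
  have h5 := factorial_mul_factorial_sub (p := p) m (by omega)
  rw [show p - 1 - m = m by omega, Nat.cast_mul] at h5
  have h6 : ((ε - (-1) ^ m : ℤ) : ZMod p) = 0 := by
    have : (ε : ZMod p) * (-1) ^ (m + 1) = -1 := by rw [← h5, h1]; ring
    have h7 : ((-1 : ZMod p) ^ m) ^ 2 = 1 := by rw [← pow_mul, mul_comm, pow_mul]; simp
    push_cast
    linear_combination (-(-1) ^ m) * this + (- (ε : ZMod p)) * h7
  rw [ZMod.intCast_zmod_eq_zero_iff_dvd] at h6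
  -- The difference of two signs is 0 or ±2, and an odd prime does not divide 2.
  have hp3 : 3 ≤ p := by have := hpp.two_le; omega
  rcases hε with rfl | rfl <;> rcases neg_one_pow_eq_or ℤ m with h8 | h8 <;> rw [h8] at h6 ⊢
  · have := Int.le_of_dvd (by norm_num) h6
    omega
  · rw [← dvd_neg] at h6
    have := Int.le_of_dvd (by norm_num) h6
    omega

end GaussSumSign

/-! ### Gauss's evaluation of the quadratic Gauss sum. -/

section GaussSumValue

open Complex

/-- The Legendre symbol modulo `p` as a complex Dirichlet character. -/
noncomputable def legendreChar (p : ℕ) [Fact p.Prime] : DirichletCharacter ℂ p :=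
  (quadraticChar (ZMod p)).ringHomComp (Int.castRingHom ℂ)

theorem legendreChar_apply (p : ℕ) [Fact p.Prime] (x : ZMod p) :
    legendreChar p x = (quadraticChar (ZMod p) x : ℂ) := rfl

theorem legendreChar_intCast (p : ℕ) [Fact p.Prime] (a : ℤ) :
    legendreChar p (a : ZMod p) = (legendreSym p a : ℂ) := rfl

theorem legendreChar_isQuadratic (p : ℕ) [Fact p.Prime] : (legendreChar p).IsQuadratic :=
  (quadraticChar_isQuadratic (ZMod p)).comp _

theorem legendreChar_ne_one {p : ℕ} [Fact p.Prime] (hp : p ≠ 2) : legendreChar p ≠ 1 := by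
  rw [legendreChar, MulChar.ringHomComp_ne_one_iff (RingHom.injective_int _)]
  exact quadraticChar_ne_one ((ZMod.ringChar_zmod_n p).substr hp)

/-- The exponents km and k(m + 1) are symmetric about kp/2, where the exponential equals (-1)^k;
factoring it out leaves 2i sin(πk/p). -/
theorem exp_pow_mul_exp_pow_sub_one {p m : ℕ} (hpm : p = 2 * m + 1) (k : ℕ) :
    exp (2 * Real.pi * I / p) ^ (k * m) * (exp (2 * Real.pi * I / p) ^ k - 1) =
      (-1) ^ k * I * (2 * Real.sin (Real.pi * k / p) : ℝ) := by
  have hp0 : (p : ℂ) ≠ 0 := by rw [Nat.cast_ne_zero]; omega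
  have hp' : (p : ℂ) = 2 * m + 1 := by rw [hpm]; push_cast; ring
  have h1 : (-1 : ℂ) ^ k = exp (k * (Real.pi * I)) := by rw [exp_nat_mul, exp_pi_mul_I]
  have h2 : ((2 * Real.sin (Real.pi * k / p) : ℝ) : ℂ) =
      (exp (-(Real.pi * k / p * I)) - exp (Real.pi * k / p * I)) * I := by
    push_cast
    rw [Complex.sin]
    ring_nf
  rw [h1, h2, ← exp_nat_mul, ← exp_nat_mul, mul_sub, mul_one, ← exp_add]
  have e1 : ((k * m : ℕ) : ℂ) * (2 * Real.pi * I / p) + k * (2 * Real.pi * I / p) =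
      k * (Real.pi * I) + Real.pi * k / p * I := by
    field_simp
    rw [hp']; push_cast; ring
  have e2 : ((k * m : ℕ) : ℂ) * (2 * Real.pi * I / p) =
      k * (Real.pi * I) + -(Real.pi * k / p * I) := by
    field_simp
    rw [hp']; push_cast; ring
  rw [e1, e2, exp_add, exp_add]
  linear_combination (exp (k * (Real.pi * I)) * (exp (-(Real.pi * k / p * I)) -
    exp (Real.pi * k / p * I))) * -I_mul_I

/-- The product of 1 - ζ^k over 0 < k < p is p, the norms of the factors are 2 sin(πk/p), and k and
p - k give equal norms. -/
theorem prod_two_mul_sin_sq {p m : ℕ} (hpm : p = 2 * m + 1) :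
    (∏ k ∈ Finset.range m, 2 * Real.sin (Real.pi * (k + 1 : ℕ) / p)) ^ 2 = p := by
  have hp0 : (0 : ℝ) < p := by rw [hpm]; positivity
  have hζ := isPrimitiveRoot_exp (2 * m + 1) (by omega)
  have h := congrArg norm hζ.prod_one_sub_pow_eq_order
  rw [norm_prod] at h
  have hn : ∀ k, k + 1 < p → ‖1 - exp (2 * Real.pi * I / (2 * m + 1 : ℕ)) ^ (k + 1)‖ =
      2 * Real.sin (Real.pi * (k + 1 : ℕ) / p) := by
    intro k hk
    have h1 := congrArg norm (exp_pow_mul_exp_pow_sub_one hpm (k + 1))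
    have h2 : 0 ≤ Real.sin (Real.pi * (k + 1 : ℕ) / p) := by
      apply Real.sin_nonneg_of_nonneg_of_le_pi (by positivity)
      rw [div_le_iff₀ hp0]
      gcongr
    rw [norm_mul, norm_pow, hpm, hζ.norm'_eq_one (by omega), one_pow, one_mul, norm_mul, norm_mul,
      norm_pow, norm_neg, norm_one, one_pow, one_mul, norm_I, one_mul, norm_real, ← hpm,
      Real.norm_of_nonneg (by positivity)] at h1
    rw [norm_sub_rev, ← h1, hpm]
  rw [Finset.prod_congr rfl fun k hk => hn k (by rw [Finset.mem_range] at hk; omega), two_mul,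
    Finset.prod_range_add, ← Finset.prod_range_reflect (fun k => 2 * Real.sin _)] at h
  have h3 : ∏ k ∈ Finset.range m, 2 * Real.sin (Real.pi * (m + k + 1 : ℕ) / p) =
      ∏ k ∈ Finset.range m, 2 * Real.sin (Real.pi * (m - 1 - k + 1 : ℕ) / p) := by
    refine Finset.prod_congr rfl fun k hk => ?_
    rw [Finset.mem_range] at hk
    rw [← Real.sin_pi_sub]
    congr 2
    have : (p : ℝ) = (m + k + 1 : ℕ) + (m - 1 - k + 1 : ℕ) := by
      rw [← Nat.cast_add]; congr 1; omega
    field_simp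
    rw [this]; ring
  rw [h3, ← sq, Finset.prod_range_reflect (fun k => 2 * Real.sin (Real.pi * (k + 1 : ℕ) / p))] at h
  rw [h, hpm, ← two_mul]
  norm_cast

theorem prod_I_mul_neg_one_pow (m : ℕ) :
    ∏ k ∈ Finset.range m, I * (-1) ^ k = if Even m then 1 else I := by
  induction m using Nat.twoStepInduction with
  | zero => simp
  | one => simp
  | more m ih _ =>
    rw [Finset.prod_range_succ, Finset.prod_range_succ, ih, pow_succ]
    have h7 : ((-1 : ℂ) ^ m) ^ 2 = 1 := by rw [← pow_mul, mul_comm, pow_mul]; simp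
    have : (I * (-1) ^ m) * (I * ((-1) ^ m * -1)) = 1 := by
      linear_combination (-((-1 : ℂ) ^ m) ^ 2) * I_mul_I + h7
    rw [mul_assoc, this, mul_one]
    simp [Nat.even_add]

/-- **Gauss's theorem** on the value of the quadratic Gauss sum. -/
theorem gaussSum_legendreChar {p : ℕ} [Fact p.Prime] (hp : p ≠ 2) :
    gaussSum (legendreChar p) ZMod.stdAddChar =
      (if p % 4 = 1 then 1 else I) * (Real.sqrt p : ℂ) := by
  have hpp : p.Prime := Fact.out
  have hodd : p % 2 = 1 := (hpp.eq_two_or_odd).resolve_left hp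
  set m := p / 2 with hm
  have hpm : p = 2 * m + 1 := by omega
  set ζ := exp (2 * Real.pi * I / p)
  have hζ : IsPrimitiveRoot ζ p := isPrimitiveRoot_exp p hpp.ne_zero
  set R := ∏ k ∈ Finset.range m, 2 * Real.sin (Real.pi * (k + 1 : ℕ) / p) with hR
  have hR2 : R ^ 2 = p := prod_two_mul_sin_sq hpm
  have hp0 : (0 : ℝ) < p := by exact_mod_cast hpp.pos
  have hR0 : 0 ≤ R := by
    refine Finset.prod_nonneg fun k hk => mul_nonneg zero_le_two ?_
    rw [Finset.mem_range] at hk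
    apply Real.sin_nonneg_of_nonneg_of_le_pi (by positivity)
    rw [div_le_iff₀ hp0]
    gcongr
    omega
  have hRs : R = Real.sqrt p := by rw [← hR2, Real.sqrt_sq hR0]
  set P := ∏ k ∈ Finset.range m, ζ ^ ((k + 1) * m) * (ζ ^ (k + 1) - 1) with hP
  have hPR : P = (-1) ^ m * (if Even m then 1 else I) * R := by
    have h1 (k : ℕ) : (-1 : ℂ) ^ (k + 1) * I = -1 * (I * (-1) ^ k) := by rw [pow_succ]; ring
    rw [hP, Finset.prod_congr rfl fun k _ => exp_pow_mul_exp_pow_sub_one hpm (k + 1),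
      Finset.prod_mul_distrib, ← ofReal_prod, Finset.prod_congr rfl fun k _ => h1 k,
      Finset.prod_mul_distrib, prod_I_mul_neg_one_pow, Finset.prod_const, Finset.card_range]
  have hτ : gaussSum (legendreChar p) ZMod.stdAddChar =
      ∑ x : ZMod p, (quadraticChar (ZMod p) x : ℂ) * ζ ^ x.val := by
    refine Finset.sum_congr rfl fun x _ => ?_
    rw [legendreChar_apply, ZMod.stdAddChar_apply, ZMod.toCircle_apply, ← exp_nat_mul]
    congr 2
    ring
  -- Both squares equal (-1)^m p, which leaves only a sign ε to determine.
  have hsq : gaussSum (legendreChar p) ZMod.stdAddChar ^ 2 = P ^ 2 := by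
    have h0 := gaussSum_sq (χ := legendreChar p) (legendreChar_ne_one hp)
      (legendreChar_isQuadratic p) (ZMod.isPrimitive_stdAddChar p)
    rw [ZMod.card] at h0
    rw [h0]
    have h1 : legendreChar p (-1) = (-1) ^ m := by
      have := legendreChar_intCast p (-1)
      rw [legendreSym.at_neg_one hp, ZMod.χ₄_eq_neg_one_pow hodd] at this
      simpa using this
    have h2 : ((R : ℂ)) ^ 2 = p := by exact_mod_cast hR2
    rw [h1, hPR, mul_pow, mul_pow, h2, ← pow_mul, mul_comm m 2, pow_mul]
    rcases Nat.even_or_odd m with he | ho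
    · simp [he, he.neg_one_pow]
    · simp [Nat.not_even_iff_odd.mpr ho, ho.neg_one_pow]
  have hε : ∃ ε : ℤ, (ε = 1 ∨ ε = -1) ∧ gaussSum (legendreChar p) ZMod.stdAddChar = ε * P := by
    rcases sq_eq_sq_iff_eq_or_eq_neg.mp hsq with h | h
    · exact ⟨1, Or.inl rfl, by simpa using h⟩
    · exact ⟨-1, Or.inr rfl, by simpa using h⟩
  obtain ⟨ε, hε, h⟩ := hε
  have := eq_neg_one_pow_of_sum_quadraticChar_eq hp hζ hε (hτ ▸ h)
  have hif : (if p % 4 = 1 then (1 : ℂ) else I) = if Even m then 1 else I := by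
    congr 1
    rw [Nat.even_iff, eq_iff_iff]
    omega
  rw [h, this, hPR, hif, ← hRs]
  have h7 : ((-1 : ℂ) ^ m) ^ 2 = 1 := by rw [← pow_mul, mul_comm, pow_mul]; simp
  push_cast
  linear_combination ((if Even m then 1 else I) * (R : ℂ)) * h7

end GaussSumValue

/-! ### The periodic zeta function at s = 1. -/

section ExpZetaAtOne

open Complex Filter Topology

/-- A summable bound uniform in s, as required for dominated convergence after summation by parts.
-/
theorem rpow_neg_sub_rpow_neg_mem_Icc (i : ℕ) {s : ℝ} (hs : s ∈ Set.Icc (1 : ℝ) 2) :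
    (i + 1 : ℝ) ^ (-s) - (i + 2 : ℝ) ^ (-s) ∈ Set.Icc 0 (2 / (i + 1 : ℝ) ^ 2) := by
  have h1 : (0 : ℝ) < i + 1 := by positivity
  have h2 : (0 : ℝ) < i + 2 := by positivity
  constructor
  · rw [sub_nonneg]
    exact Real.rpow_le_rpow_of_nonpos h1 (by linarith) (by linarith [hs.1])
  · have e : (i + 2 : ℝ) ^ (-s) = (i + 1 : ℝ) ^ (-s) * ((i + 1) / (i + 2) : ℝ) ^ s := by
      rw [Real.div_rpow h1.le h2.le, Real.rpow_neg h1.le, Real.rpow_neg h2.le]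
      have := (Real.rpow_pos_of_pos h1 s).ne'
      field_simp
    have h3 : ((i + 1) / (i + 2) : ℝ) ^ (2 : ℝ) ≤ ((i + 1) / (i + 2) : ℝ) ^ s :=
      Real.rpow_le_rpow_of_exponent_ge (by positivity) (by rw [div_le_one h2]; linarith) hs.2
    have h4 : (i + 1 : ℝ) ^ (-s) ≤ (i + 1 : ℝ) ^ (-1 : ℝ) :=
      Real.rpow_le_rpow_of_exponent_le (by linarith [Nat.cast_nonneg (α := ℝ) i])
        (by linarith [hs.1])
    rw [Real.rpow_two] at h3
    rw [Real.rpow_neg_one] at h4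
    have h5 : 1 - ((i + 1) / (i + 2) : ℝ) ^ 2 ≤ 2 / (i + 1) := by
      rw [div_pow, one_sub_div (by positivity), div_le_div_iff₀ (by positivity) h1]
      nlinarith [Nat.cast_nonneg (α := ℝ) i]
    have h6 : (0 : ℝ) ≤ 1 - ((i + 1) / (i + 2) : ℝ) ^ 2 := by
      rw [sub_nonneg]
      exact pow_le_one₀ (by positivity) (by rw [div_le_one h2]; linarith)
    calc (i + 1 : ℝ) ^ (-s) - (i + 2 : ℝ) ^ (-s)
        = (i + 1 : ℝ) ^ (-s) * (1 - ((i + 1) / (i + 2) : ℝ) ^ s) := by rw [e]; ring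
      _ ≤ (i + 1 : ℝ) ^ (-s) * (1 - ((i + 1) / (i + 2) : ℝ) ^ 2) := by gcongr
      _ ≤ (i + 1 : ℝ)⁻¹ * (2 / (i + 1)) := by gcongr
      _ = 2 / (i + 1 : ℝ) ^ 2 := by field_simp

theorem summable_two_div_add_one_sq_mul (C : ℝ) :
    Summable fun i : ℕ => 2 / (i + 1 : ℝ) ^ 2 * C := by
  have := (summable_nat_add_iff 1).mpr (Real.summable_one_div_nat_pow.mpr one_lt_two)
  refine (this.mul_left (2 * C)).congr fun i => ?_
  push_cast
  ring

/-- Dirichlet series with bounded coefficient sums converge for `s ∈ [1, 2]`, and the sum is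
right-continuous at `s = 1`. -/
theorem exists_tendsto_dirichletSeries_of_bounded {a : ℕ → ℂ} {C : ℝ}
    (hC : ∀ n, ‖∑ i ∈ Finset.range n, a i‖ ≤ C) :
    ∃ G : ℝ → ℂ, Tendsto G (𝓝[>] 1) (𝓝 (G 1)) ∧ ∀ s ∈ Set.Icc (1 : ℝ) 2,
      Tendsto (fun n => ∑ i ∈ Finset.range n, (i + 1 : ℝ) ^ (-s) • a i) atTop (𝓝 (G s)) := by
  have hbound (s : ℝ) (hs : s ∈ Set.Icc (1 : ℝ) 2) (i : ℕ) :
      ‖((i + 1 : ℝ) ^ (-s) - (i + 2 : ℝ) ^ (-s)) • ∑ j ∈ Finset.range (i + 1), a j‖ ≤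
        2 / (i + 1 : ℝ) ^ 2 * C := by
    have h := rpow_neg_sub_rpow_neg_mem_Icc i hs
    rw [norm_smul, Real.norm_of_nonneg h.1]
    exact mul_le_mul h.2 (hC _) (norm_nonneg _) (by positivity)
  refine ⟨fun s => ∑' i : ℕ, ((i + 1 : ℝ) ^ (-s) - (i + 2 : ℝ) ^ (-s)) •
    ∑ j ∈ Finset.range (i + 1), a j, ?_, fun s hs => ?_⟩
  · refine tendsto_tsum_of_dominated_convergence (summable_two_div_add_one_sq_mul C)
      (fun i => ?_) ?_
    · refine Tendsto.mono_left ?_ nhdsWithin_le_nhds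
      have h1 : (i + 1 : ℝ) ≠ 0 := by positivity
      have h2 : (i + 2 : ℝ) ≠ 0 := by positivity
      have : Continuous fun s : ℝ => ((i + 1 : ℝ) ^ (-s) - (i + 2 : ℝ) ^ (-s)) •
          ∑ j ∈ Finset.range (i + 1), a j :=
        ((continuous_const.rpow continuous_neg fun _ => Or.inl h1).sub
          (continuous_const.rpow continuous_neg fun _ => Or.inl h2)).smul continuous_const
      exact this.tendsto 1
    · filter_upwards [Ioo_mem_nhdsGT one_lt_two] with s hs i
      exact hbound s ⟨hs.1.le, hs.2.le⟩ i
  · rw [← tendsto_add_atTop_iff_nat 1]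
    have hparts (n : ℕ) : ∑ i ∈ Finset.range (n + 1), (i + 1 : ℝ) ^ (-s) • a i =
        (n + 1 : ℝ) ^ (-s) • ∑ i ∈ Finset.range (n + 1), a i +
        ∑ i ∈ Finset.range n, ((i + 1 : ℝ) ^ (-s) - (i + 2 : ℝ) ^ (-s)) •
          ∑ j ∈ Finset.range (i + 1), a j := by
      rw [Finset.sum_range_by_parts (fun i : ℕ => (i + 1 : ℝ) ^ (-s)), Nat.add_sub_cancel,
        sub_eq_add_neg, ← Finset.sum_neg_distrib]
      congr 1
      refine Finset.sum_congr rfl fun i _ => ?_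
      rw [← neg_smul, neg_sub]
      push_cast
      ring_nf
    simp_rw [hparts]
    rw [← zero_add (tsum _)]
    refine Tendsto.add ?_ (HasSum.tendsto_sum_nat (Summable.hasSum
      (Summable.of_norm_bounded (summable_two_div_add_one_sq_mul C) (hbound s hs))))
    refine squeeze_zero_norm (a := fun n : ℕ => (n + 1 : ℝ) ^ (-s) * C) (fun n => ?_) ?_
    · rw [norm_smul, Real.norm_of_nonneg (by positivity)]
      exact mul_le_mul_of_nonneg_left (hC _) (by positivity)
    · have h := ((tendsto_rpow_neg_atTop (by linarith [hs.1] : 0 < s)).comp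
        ((tendsto_natCast_atTop_atTop (R := ℝ)).comp (tendsto_add_atTop_nat 1))).mul_const C
      simpa [Function.comp_def] using h

theorem norm_sum_range_pow_succ_le {z : ℂ} (hz : ‖z‖ = 1) (hz1 : z ≠ 1) (n : ℕ) :
    ‖∑ i ∈ Finset.range n, z ^ (i + 1)‖ ≤ 2 / ‖z - 1‖ := by
  simp_rw [pow_succ]
  rw [← Finset.sum_mul, geom_sum_eq hz1, norm_mul, hz, mul_one, norm_div]
  gcongr
  calc ‖z ^ n - 1‖ ≤ ‖z ^ n‖ + ‖(1 : ℂ)‖ := norm_sub_le _ _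
    _ = 2 := by rw [norm_pow, hz]; norm_num

theorem one_sub_mem_slitPlane {z : ℂ} (hz : ‖z‖ = 1) (hz1 : z ≠ 1) : 1 - z ∈ slitPlane := by
  rw [mem_slitPlane_iff]
  by_contra! h
  have him : z.im = 0 := by simpa using h.2
  have hre : 1 ≤ z.re := by simpa using h.1
  have := Complex.re_le_norm z
  exact hz1 (Complex.ext (by simp; linarith) (by simpa using him))

/-- Abel's limit theorem along the radius to z, where the Taylor series of the logarithm converges
absolutely. -/
theorem eq_neg_log_of_tendsto_sum {z l : ℂ} (hz : ‖z‖ = 1) (hz1 : z ≠ 1)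
    (h : Tendsto (fun n => ∑ i ∈ Finset.range n, z ^ (i + 1) / (i + 1)) atTop (𝓝 l)) :
    l = -log (1 - z) := by
  have h1 : Tendsto (fun n => ∑ i ∈ Finset.range n, z ^ i / i) atTop (𝓝 l) := by
    rw [← tendsto_add_atTop_iff_nat 1]
    simpa [Finset.sum_range_succ'] using h
  have h2 := tendsto_tsum_powerSeries_nhdsWithin_lt h1
  rw [tendsto_map'_iff] at h2
  have h3 : Tendsto (fun r : ℝ => -log (1 - z * r)) (𝓝[<] 1) (𝓝 (-log (1 - z))) := by
    refine Tendsto.mono_left ?_ nhdsWithin_le_nhds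
    have hc : ContinuousAt (fun r : ℝ => -log (1 - z * r)) 1 := by
      refine (ContinuousAt.clog (by fun_prop) ?_).neg
      simpa using one_sub_mem_slitPlane hz hz1
    simpa using hc.tendsto
  refine tendsto_nhds_unique h2 (h3.congr' ?_)
  filter_upwards [Ioo_mem_nhdsLT (show (-1 : ℝ) < 1 by norm_num)] with r hr
  have h4 : ‖z * r‖ < 1 := by
    rw [norm_mul, hz, one_mul, norm_real, Real.norm_eq_abs, abs_lt]
    exact hr
  rw [← (hasSum_taylorSeries_neg_log h4).tsum_eq]
  refine tsum_congr fun n => ?_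
  rw [mul_pow]
  ring

/-- The Dirichlet series is known to represent `expZeta` only for s > 1. Its conditionally
convergent value at 1 is identified by right-continuity of both sides. -/
theorem expZeta_one {x : ℝ} (hx : (x : UnitAddCircle) ≠ 0) :
    HurwitzZeta.expZeta x 1 = -log (1 - exp (2 * Real.pi * I * x)) := by
  set z := exp (2 * Real.pi * I * x) with hzdef
  have hz : ‖z‖ = 1 := by
    rw [hzdef, show (2 * Real.pi * I * x : ℂ) = ((2 * Real.pi * x : ℝ) : ℂ) * I by push_cast; ring]
    exact norm_exp_ofReal_mul_I _
  have hz1 : z ≠ 1 := by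
    rw [hzdef, Ne, exp_eq_one_iff]
    rintro ⟨n, hn⟩
    apply hx
    rw [AddCircle.coe_eq_zero_iff]
    refine ⟨n, ?_⟩
    have h2 : (2 * Real.pi * I : ℂ) ≠ 0 := two_pi_I_ne_zero
    have h3 : (x : ℂ) = n := by
      apply mul_left_cancel₀ h2
      rw [hn]; ring
    rw [zsmul_eq_mul, mul_one]
    exact_mod_cast h3.symm
  obtain ⟨G, hG, hlim⟩ := exists_tendsto_dirichletSeries_of_bounded
    (norm_sum_range_pow_succ_le hz hz1)
  have hGs (s : ℝ) (hs : s ∈ Set.Ioo (1 : ℝ) 2) : G s = HurwitzZeta.expZeta x s := by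
    have h1 := (HurwitzZeta.hasSum_expZeta_of_one_lt_re x (s := s)
      (by simpa using hs.1)).tendsto_sum_nat
    rw [← tendsto_add_atTop_iff_nat 1] at h1
    refine tendsto_nhds_unique (hlim s ⟨hs.1.le, hs.2.le⟩) (h1.congr fun n => ?_)
    have hs0 : (s : ℂ) ≠ 0 := by
      rw [ofReal_ne_zero]; linarith [hs.1]
    rw [Finset.sum_range_succ']
    simp only [Nat.cast_zero, zero_cpow hs0, div_zero, add_zero]
    refine Finset.sum_congr rfl fun i _ => ?_
    rw [hzdef, ← exp_nat_mul, real_smul, ofReal_cpow (by positivity), ofReal_neg, cpow_neg]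
    push_cast
    rw [div_eq_inv_mul]
    congr 2
    ring
  have hG1 : G 1 = HurwitzZeta.expZeta x 1 := by
    refine tendsto_nhds_unique hG ?_
    have h1 : ContinuousAt (fun s : ℝ => HurwitzZeta.expZeta x s) 1 :=
      ContinuousAt.comp (f := ofReal)
        (HurwitzZeta.differentiable_expZeta_of_ne_zero hx _).continuousAt
        continuous_ofReal.continuousAt
    have h2 := h1.tendsto.mono_left (nhdsWithin_le_nhds (s := Set.Ioi 1))
    rw [ofReal_one] at h2
    refine h2.congr' ?_
    filter_upwards [Ioo_mem_nhdsGT one_lt_two] with s hs using (hGs s hs).symm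
  rw [← hG1]
  refine eq_neg_log_of_tendsto_sum hz hz1 ((hlim 1 (by norm_num)).congr fun n => ?_)
  refine Finset.sum_congr rfl fun i _ => ?_
  rw [Real.rpow_neg_one, real_smul]
  push_cast
  rw [div_eq_inv_mul]

/-- Here 1 - e(x) is 2 sin(πx) > 0 times a unit of argument πx - π/2, which lies in the principal
range. -/
theorem expZeta_one_im {x : ℝ} (hx : x ∈ Set.Ioo (0 : ℝ) 1) :
    (HurwitzZeta.expZeta x 1).im = Real.pi * (1 / 2 - x) := by
  have hx0 : (x : UnitAddCircle) ≠ 0 := by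
    rw [Ne, AddCircle.coe_eq_zero_iff_of_mem_Ico ⟨hx.1.le, by simpa using hx.2⟩]
    exact hx.1.ne'
  have hs : 0 < Real.sin (Real.pi * x) :=
    Real.sin_pos_of_pos_of_lt_pi (mul_pos Real.pi_pos hx.1)
      (by nlinarith [Real.pi_pos, hx.2])
  have h1 : 1 - exp (2 * Real.pi * I * x) = (2 * Real.sin (Real.pi * x) : ℝ) *
      exp ((Real.pi * x - Real.pi / 2 : ℝ) * I) := by
    push_cast
    rw [sub_mul, exp_sub, exp_pi_div_two_mul_I,
      Complex.sin, div_I, show (2 * Real.pi * I * x : ℂ) = Real.pi * x * I + Real.pi * x * I by ring,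
      exp_add]
    have : exp (-(Real.pi * x : ℂ) * I) * exp (Real.pi * x * I) = 1 := by
      rw [← exp_add]; simp
    linear_combination (-1 : ℂ) * this + (exp (-(Real.pi * x : ℂ) * I) * exp (Real.pi * x * I) -
      exp (Real.pi * x * I) * exp (Real.pi * x * I)) * I_mul_I
  rw [expZeta_one hx0, neg_im, log_im, h1, arg_real_mul _ (by positivity), arg_exp_mul_I,
    (toIocMod_eq_self _).mpr]
  · ring
  · constructor <;> nlinarith [Real.pi_pos, hx.1, hx.2]

end ExpZetaAtOne

/-! ### Positivity of L(1, ψ) and its finite form. -/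

section Positivity

open Complex Filter Topology
open scoped ComplexOrder

/-- The coefficients of ζ(s)L(s, ψ) are nonnegative for real ψ, and ζ(s) > 0. -/
theorem LFunction_nonneg_of_sq_eq_one {N : ℕ} [NeZero N] {ψ : DirichletCharacter ℂ N}
    (hψ : ψ ^ 2 = 1) {s : ℝ} (hs : 1 < s) : 0 ≤ ψ.LFunction s := by
  have hs' : 1 < (s : ℂ).re := by simpa using hs
  have hz : 0 < LSeries (1 : ℕ → ℂ) s := by
    refine LSeries.positive (fun n => zero_le_one) one_pos ?_
    change LSeries.abscissaOfAbsConv 1 < _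
    rw [LSeries.abscissaOfAbsConv_one]
    exact_mod_cast hs
  have hzm : 0 ≤ LSeries ψ.zetaMul s :=
    tsum_nonneg fun n => LSeries.term_nonneg (DirichletCharacter.zetaMul_nonneg hψ n) s
  have hmul : LSeries ψ.zetaMul s = LSeries (1 : ℕ → ℂ) s * ψ.LFunction s := by
    rw [DirichletCharacter.zetaMul, ← ArithmeticFunction.coe_mul, LSeries_convolution',
      DirichletCharacter.LFunction_eq_LSeries ψ hs']
    · congr 1
      · rw [← ArithmeticFunction.LSeries_zeta_eq]
        simp_rw [← ArithmeticFunction.natCoe_apply]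
      · exact (LSeries_congr ψ.apply_eq_toArithmeticFunction_apply s).symm
    · exact ArithmeticFunction.LSeriesSummable_zeta_iff.mpr hs'
    · exact (LSeriesSummable_congr _ fun h => (ψ.apply_eq_toArithmeticFunction_apply h).symm).mpr
        (ZMod.LSeriesSummable_of_one_lt_re ψ hs')
  rw [hmul] at hzm
  by_contra hneg
  obtain ⟨hz1, hz2⟩ := Complex.pos_iff.mp hz
  obtain ⟨h1, h2⟩ := Complex.nonneg_iff.mp hzm
  rw [mul_re, ← hz2, zero_mul, sub_zero] at h1
  rw [mul_im, ← hz2, zero_mul, add_zero] at h2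
  refine hneg (Complex.nonneg_iff.mpr ⟨nonneg_of_mul_nonneg_right h1 hz1, ?_⟩)
  exact ((mul_eq_zero.mp h2.symm).resolve_left hz1.ne').symm

/-- The `L`-function of a nontrivial quadratic character is positive at `1`. -/
theorem LFunction_one_pos {N : ℕ} [NeZero N] {ψ : DirichletCharacter ℂ N}
    (hψ : ψ ^ 2 = 1) (hψ1 : ψ ≠ 1) : 0 < ψ.LFunction 1 := by
  -- Strictness is Dirichlet's nonvanishing theorem; the weak inequality is a limit from s > 1.
  refine lt_of_le_of_ne ?_ (DirichletCharacter.LFunction_apply_one_ne_zero hψ1).symm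
  have h1 : ContinuousAt (fun s : ℝ => ψ.LFunction s) 1 :=
    ContinuousAt.comp (f := ofReal)
      (DirichletCharacter.differentiable_LFunction hψ1 _).continuousAt
      continuous_ofReal.continuousAt
  have h2 := h1.tendsto.mono_left (nhdsWithin_le_nhds (s := Set.Ioi 1))
  rw [ofReal_one] at h2
  refine ge_of_tendsto h2 ?_
  filter_upwards [self_mem_nhdsWithin] with s hs using LFunction_nonneg_of_sq_eq_one hψ hs

/-- For s > 1 the series agree term by term; continuity carries the identity to s = 1 without
handling conditional convergence. Nonintegral x and nontrivial ψ exclude poles. -/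
theorem sum_mul_expZeta_one_eq {N : ℕ} [NeZero N] {ψ : DirichletCharacter ℂ N} (hψ1 : ψ ≠ 1)
    {ι : Type*} (t : Finset ι) {c x : ι → ℝ} (hx : ∀ k ∈ t, (x k : UnitAddCircle) ≠ 0) {κ : ℂ}
    (h : ∀ n : ℕ, ∑ k ∈ t, (c k : ℂ) * exp (2 * Real.pi * I * x k * n) = κ * ψ n) :
    ∑ k ∈ t, (c k : ℂ) * HurwitzZeta.expZeta (x k) 1 = κ * ψ.LFunction 1 := by
  have heq (s : ℝ) (hs : 1 < s) :
      ∑ k ∈ t, (c k : ℂ) * HurwitzZeta.expZeta (x k) s = κ * ψ.LFunction s := by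
    have hs' : 1 < (s : ℂ).re := by simpa using hs
    have hs0 : (s : ℂ) ≠ 0 := by rw [ofReal_ne_zero]; linarith
    have h1 : HasSum (fun n : ℕ => ∑ k ∈ t, (c k : ℂ) * (exp (2 * Real.pi * I * x k * n) / n ^ (s : ℂ)))
        (∑ k ∈ t, (c k : ℂ) * HurwitzZeta.expZeta (x k) s) :=
      hasSum_sum fun k _ => (HurwitzZeta.hasSum_expZeta_of_one_lt_re (x k) hs').mul_left _
    have h2 : HasSum (fun n : ℕ => κ * LSeries.term (ψ ·) s n) (κ * ψ.LFunction s) := by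
      rw [DirichletCharacter.LFunction_eq_LSeries ψ hs']
      exact (ψ.LSeriesSummable_of_one_lt_re hs').hasSum.mul_left _
    refine h1.unique (h2.congr_fun fun n => ?_)
    rw [LSeries.term_of_ne_zero' hs0, ← mul_div_assoc, ← h n, Finset.sum_div]
    simp only [mul_div_assoc]
  have hc1 : Continuous fun s : ℝ => ∑ k ∈ t, (c k : ℂ) * HurwitzZeta.expZeta (x k) s :=
    continuous_finsetSum _ fun k hk => continuous_const.mul
      ((HurwitzZeta.differentiable_expZeta_of_ne_zero (hx k hk)).continuous.comp continuous_ofReal)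
  have hc2 : Continuous fun s : ℝ => κ * ψ.LFunction s :=
    continuous_const.mul
      ((DirichletCharacter.differentiable_LFunction hψ1).continuous.comp continuous_ofReal)
  have t1 := (hc1.tendsto 1).mono_left (nhdsWithin_le_nhds (s := Set.Ioi 1))
  have t2 := (hc2.tendsto 1).mono_left (nhdsWithin_le_nhds (s := Set.Ioi 1))
  have := tendsto_nhds_unique t1 (t2.congr' (by
    filter_upwards [self_mem_nhdsWithin] with s hs using (heq s hs).symm))
  simpa using this

theorem coe_ne_zero_of_fract_ne_zero {x : ℝ} (hx : Int.fract x ≠ 0) :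
    (x : UnitAddCircle) ≠ 0 := by
  rw [Ne, AddCircle.coe_eq_zero_iff]
  rintro ⟨n, rfl⟩
  simp at hx

theorem expZeta_one_im_of_fract_ne_zero {x : ℝ} (hx : Int.fract x ≠ 0) :
    (HurwitzZeta.expZeta x 1).im = Real.pi * (1 / 2 - Int.fract x) := by
  have h : ((Int.fract x : ℝ) : UnitAddCircle) = x := by
    rw [Int.fract, AddCircle.coe_sub, sub_eq_self, AddCircle.coe_eq_zero_iff]
    exact ⟨⌊x⌋, by simp⟩
  rw [← expZeta_one_im ⟨lt_of_le_of_ne (Int.fract_nonneg x) hx.symm, Int.fract_lt_one x⟩, h]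

/-- If a nontrivial quadratic character `ψ` has a finite Fourier expansion
`i r ψ(n) = ∑ c_k e(n x_k)` with `r > 0`, real `c_k` and non-integral `x_k`, then
`∑ c_k (1/2 - {x_k})` is positive. -/
theorem sum_mul_half_sub_fract_pos {N : ℕ} [NeZero N] {ψ : DirichletCharacter ℂ N}
    (hψ : ψ ^ 2 = 1) (hψ1 : ψ ≠ 1) {ι : Type*} (t : Finset ι) {c x : ι → ℝ}
    (hx : ∀ k ∈ t, Int.fract (x k) ≠ 0) {r : ℝ} (hr : 0 < r)
    (h : ∀ n : ℕ, ∑ k ∈ t, (c k : ℂ) * exp (2 * Real.pi * I * x k * n) = I * r * ψ n) :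
    0 < ∑ k ∈ t, c k * (1 / 2 - Int.fract (x k)) := by
  have h1 := congrArg im
    (sum_mul_expZeta_one_eq hψ1 t (fun k hk => coe_ne_zero_of_fract_ne_zero (hx k hk)) h)
  have hL := Complex.pos_iff.mp (LFunction_one_pos hψ hψ1)
  rw [im_sum, mul_assoc, I_mul_im, re_ofReal_mul] at h1
  have h2 : Real.pi * ∑ k ∈ t, c k * (1 / 2 - Int.fract (x k)) = r * (ψ.LFunction 1).re := by
    rw [← h1, Finset.mul_sum]
    refine Finset.sum_congr rfl fun k hk => ?_
    rw [im_ofReal_mul, expZeta_one_im_of_fract_ne_zero (hx k hk)]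
    ring
  have h3 : 0 < Real.pi * ∑ k ∈ t, c k * (1 / 2 - Int.fract (x k)) := by
    rw [h2]; exact mul_pos hr hL.1
  exact pos_of_mul_pos_right h3 Real.pi_pos.le

end Positivity

/-! ### From Gauss sums to finite sums of Legendre symbols. -/

section LegendreSums

open Complex

theorem changeLevel_mul_changeLevel_natCast {R : Type*} [CommRing R] {M M' : ℕ}
    (χ : DirichletCharacter R M) (χ' : DirichletCharacter R M') (n : ℕ) :
    (DirichletCharacter.changeLevel (dvd_mul_right M M') χ *
      DirichletCharacter.changeLevel (dvd_mul_left M' M) χ') (n : ZMod (M * M')) =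
      χ n * χ' n := by
  by_cases h : n.Coprime (M * M')
  · have h1 : IsCoprime (n : ℤ) ((M * M' : ℕ) : ℤ) := Nat.isCoprime_iff_coprime.mpr h
    have h2 := χ.changeLevel_eq_cast_of_dvd' (dvd_mul_right M M') h1
    have h3 := χ'.changeLevel_eq_cast_of_dvd' (dvd_mul_left M' M) h1
    simp only [Int.cast_natCast] at h2 h3
    rw [MulChar.mul_apply, h2, h3]
  · rw [MulChar.map_nonunit _ ((ZMod.isUnit_iff_coprime n _).not.mpr h)]
    rw [Nat.coprime_mul_iff_right, not_and_or] at h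
    rcases h with h | h
    · rw [χ.map_nonunit ((ZMod.isUnit_iff_coprime n _).not.mpr h), zero_mul]
    · rw [χ'.map_nonunit ((ZMod.isUnit_iff_coprime n _).not.mpr h), mul_zero]

theorem sum_legendreSym_mul_exp {p : ℕ} [Fact p.Prime] (hp : p ≠ 2) (n : ℕ) :
    ∑ a ∈ Finset.Icc 1 (p - 1), (legendreSym p a : ℂ) * exp (2 * Real.pi * I * (a / p) * n) =
      legendreChar p n * gaussSum (legendreChar p) ZMod.stdAddChar := by
  have hpp : p.Prime := Fact.out
  have h1 : ∑ a ∈ Finset.Icc 1 (p - 1),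
      (legendreSym p a : ℂ) * exp (2 * Real.pi * I * (a / p) * n) =
      gaussSum (legendreChar p) (AddChar.mulShift ZMod.stdAddChar (n : ZMod p)) := by
    have h2 : ∀ a : ℕ, (legendreSym p a : ℂ) * exp (2 * Real.pi * I * (a / p) * n) =
        legendreChar p (a : ZMod p) * AddChar.mulShift ZMod.stdAddChar (n : ZMod p) (a : ZMod p) := by
      intro a
      have := legendreChar_intCast p a
      rw [Int.cast_natCast] at this
      rw [this, AddChar.mulShift_apply, ← Nat.cast_mul, ZMod.stdAddChar_apply,
        ZMod.toCircle_natCast]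
      congr 2
      push_cast
      ring
    rw [Finset.sum_congr rfl fun a _ => h2 a, gaussSum]
    rw [← Finset.sum_subset (Finset.subset_univ (Finset.univ.erase (0 : ZMod p)))]
    · refine Finset.sum_bij' (fun a _ => (a : ZMod p)) (fun x _ => x.val) ?_ ?_ ?_ ?_ ?_
      · intro a ha
        rw [Finset.mem_Icc] at ha
        rw [Finset.mem_erase, Ne, ZMod.natCast_eq_zero_iff]
        exact ⟨fun h => absurd (Nat.le_of_dvd (by omega) h) (by omega), Finset.mem_univ _⟩
      · intro x hx
        have h3 := ZMod.val_lt x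
        have h4 : x.val ≠ 0 := by
          rw [Ne, ZMod.val_eq_zero]; exact (Finset.mem_erase.mp hx).1
        rw [Finset.mem_Icc]
        omega
      · intro a ha
        rw [Finset.mem_Icc] at ha
        exact ZMod.val_natCast_of_lt (by omega)
      · intro x _
        exact ZMod.natCast_zmod_val x
      · intro a _
        rfl
    · intro x _ hx
      have : x = 0 := by simpa using hx
      rw [this, MulChar.map_zero, zero_mul]
  rw [h1]
  -- When p divides n both sides vanish; otherwise n is a unit and can be scaled out.
  by_cases hn : (n : ZMod p) = 0
  · rw [hn, MulChar.map_zero, zero_mul, AddChar.mulShift_zero,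
      gaussSum_one_right (legendreChar_ne_one hp)]
  · have h3 := gaussSum_mulShift_eq (legendreChar p) ZMod.stdAddChar (Units.mk0 _ hn)
    rw [Units.val_mk0, (legendreChar_isQuadratic p).inv] at h3
    exact h3

theorem exp_two_pi_half_mul_nat (n : ℕ) : exp (2 * Real.pi * I * (1 / 2) * n) = (-1) ^ n := by
  rw [mul_comm, exp_nat_mul, show (2 * Real.pi * I * (1 / 2) : ℂ) = Real.pi * I by ring,
    exp_pi_mul_I]

theorem exp_two_pi_fourth_mul_nat (n : ℕ) : exp (2 * Real.pi * I * (1 / 4) * n) = I ^ n := by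
  rw [mul_comm, exp_nat_mul, show (2 * Real.pi * I * (1 / 4) : ℂ) = Real.pi / 2 * I by ring,
    exp_pi_div_two_mul_I]

/-- The factor e(αn)(1 - (-1)^n) is e(αn) - e((α + 1/2)n), so each a contributes two frequencies
with opposite coefficients and the constants 1/2 cancel. The choices α = 1/4 and α = 0 produce χ₄
and the principal character mod 2. -/
theorem sum_legendreSym_mul_fract_sub_fract_pos {p : ℕ} [Fact p.Prime] (hp : p ≠ 2) {N : ℕ}
    [NeZero N] {ψ : DirichletCharacter ℂ N} (hψ : ψ ^ 2 = 1) (hψ1 : ψ ≠ 1) {α r : ℝ} (hr : 0 < r)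
    (hα : ∀ a ∈ Finset.Icc 1 (p - 1), Int.fract (a / p + α : ℝ) ≠ 0 ∧
      Int.fract (a / p + (α + 1 / 2) : ℝ) ≠ 0)
    (h : ∀ n : ℕ, legendreChar p n * gaussSum (legendreChar p) ZMod.stdAddChar *
      (exp (2 * Real.pi * I * α * n) * (1 - (-1) ^ n)) = I * r * ψ n) :
    0 < ∑ a ∈ Finset.Icc 1 (p - 1), (legendreSym p a : ℝ) *
      (Int.fract (a / p + (α + 1 / 2) : ℝ) - Int.fract (a / p + α : ℝ)) := by
  have key := sum_mul_half_sub_fract_pos hψ hψ1 (Finset.Icc 1 (p - 1) ×ˢ Finset.univ)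
    (c := fun k : ℕ × Bool => if k.2 then (legendreSym p k.1 : ℝ) else -(legendreSym p k.1 : ℝ))
    (x := fun k => if k.2 then (k.1 / p + α : ℝ) else (k.1 / p + (α + 1 / 2) : ℝ)) ?_ hr ?_
  · rw [Finset.sum_product] at key
    refine key.trans_eq (Finset.sum_congr rfl fun a _ => ?_)
    simp only [Fintype.sum_bool, if_true, Bool.false_eq_true, if_false]
    ring
  · rintro ⟨a, b⟩ hk
    have := hα a (Finset.mem_product.mp hk).1
    cases b
    · simpa using this.2
    · simpa using this.1
  · intro n
    rw [← h n, ← sum_legendreSym_mul_exp hp, Finset.sum_product, Finset.sum_mul]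
    refine Finset.sum_congr rfl fun a _ => ?_
    simp only [Fintype.sum_bool, if_true, Bool.false_eq_true, if_false]
    push_cast
    rw [← exp_two_pi_half_mul_nat, mul_add, mul_add, mul_add, add_mul, add_mul, add_mul, exp_add,
      exp_add, exp_add]
    ring

theorem fract_natCast_div_ne_zero {b q : ℕ} (hq : q ≠ 0) (h : ¬ q ∣ b) : Int.fract (b / q : ℝ) ≠ 0 := by
  rw [Ne, Int.fract_eq_zero_iff]
  rintro ⟨z, hz⟩
  apply h
  rw [eq_div_iff (Nat.cast_ne_zero.mpr hq)] at hz
  have : (b : ℤ) = q * z := by rw [mul_comm]; exact_mod_cast hz.symm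
  exact Int.natCast_dvd_natCast.mp ⟨z, this⟩

theorem sum_Icc_eq_sum_half {M : Type*} [AddCommMonoid M] {p : ℕ} (hp : p % 2 = 1) (f : ℕ → M) :
    ∑ a ∈ Finset.Icc 1 (p - 1), f a = ∑ a ∈ Finset.Icc 1 ((p - 1) / 2), (f a + f (p - a)) := by
  have h1 : Finset.Icc 1 (p - 1) = Finset.Icc 1 ((p - 1) / 2) ∪
      Finset.Icc ((p - 1) / 2 + 1) (p - 1) := by
    ext a; simp only [Finset.mem_union, Finset.mem_Icc]; omega
  rw [h1, Finset.sum_union, Finset.sum_add_distrib]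
  · congr 1
    refine Finset.sum_bij' (fun a _ => p - a) (fun a _ => p - a) ?_ ?_ ?_ ?_ ?_ <;>
      intro a ha <;> rw [Finset.mem_Icc] at ha
    · rw [Finset.mem_Icc]; omega
    · rw [Finset.mem_Icc]; omega
    · omega
    · omega
    · congr 1; omega
  · rw [Finset.disjoint_left]
    intro a; simp only [Finset.mem_Icc]; omega

theorem legendreSym_sub_natCast {p : ℕ} [Fact p.Prime] {a : ℕ} (ha : a ≤ p) :
    legendreSym p ((p - a : ℕ) : ℤ) = legendreSym p (-1) * legendreSym p a := by
  rw [← legendreSym.mul, legendreSym, legendreSym]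
  congr 1
  push_cast [ha]
  simp

/-- Reindexing the alternating half-sum by doubling modulo `p`, up to sign. -/
theorem sum_legendreSym_mul_neg_one_pow {p : ℕ} [Fact p.Prime] (hp : p % 2 = 1) :
    ∑ a ∈ Finset.Icc 1 ((p - 1) / 2), legendreSym p a * (-1 : ℤ) ^ a =
      legendreSym p 2 * ∑ a ∈ Finset.Icc 1 ((p - 1) / 2),
        legendreSym p a * (if 4 * a < p then 1 else -legendreSym p (-1)) := by
  rw [Finset.mul_sum]
  symm
  refine Finset.sum_bij' (fun a _ => if 4 * a < p then 2 * a else p - 2 * a)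
    (fun b _ => if b % 2 = 0 then b / 2 else (p - b) / 2) ?_ ?_ ?_ ?_ ?_ <;>
    intro a ha <;> rw [Finset.mem_Icc] at ha
  · rw [Finset.mem_Icc]; split_ifs <;> omega
  · rw [Finset.mem_Icc]; split_ifs <;> omega
  · split_ifs <;> omega
  · split_ifs <;> omega
  · have h2 : legendreSym p ((2 * a : ℕ) : ℤ) = legendreSym p 2 * legendreSym p a := by
      rw [← legendreSym.mul]; push_cast; rfl
    split_ifs with h
    · rw [h2, (even_two_mul a).neg_one_pow, mul_one, mul_one]
    · have ho : Odd (p - 2 * a) := by rw [Nat.odd_iff]; omega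
      rw [legendreSym_sub_natCast (by omega), h2, ho.neg_one_pow]
      ring

end LegendreSums

/-! ### The two residue classes of p modulo 4. -/

section Main

open Complex

theorem changeLevel_mul_changeLevel_sq_eq_one {R : Type*} [CommRing R] {M M' : ℕ}
    {χ : DirichletCharacter R M} {χ' : DirichletCharacter R M'} (h : χ ^ 2 = 1) (h' : χ' ^ 2 = 1) :
    (DirichletCharacter.changeLevel (dvd_mul_right M M') χ *
      DirichletCharacter.changeLevel (dvd_mul_left M' M) χ') ^ 2 = 1 := by
  rw [mul_pow, ← map_pow, ← map_pow, h, h', map_one, map_one, mul_one]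

/-- Evaluation at -1 suffices, since both characters ψ used below are odd. -/
theorem changeLevel_mul_changeLevel_ne_one {R : Type*} [CommRing R] {M M' : ℕ}
    {χ : DirichletCharacter R M} {χ' : DirichletCharacter R M'} (h : χ (-1) * χ' (-1) ≠ 1) :
    DirichletCharacter.changeLevel (dvd_mul_right M M') χ *
      DirichletCharacter.changeLevel (dvd_mul_left M' M) χ' ≠ 1 := by
  intro h1
  have hc : IsCoprime (-1 : ℤ) ((M * M' : ℕ) : ℤ) := isCoprime_one_left.neg_left
  have h2 := χ.changeLevel_eq_cast_of_dvd' (dvd_mul_right M M') hc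
  have h3 := χ'.changeLevel_eq_cast_of_dvd' (dvd_mul_left M' M) hc
  have h4 := congrArg (fun ψ : DirichletCharacter R (M * M') => ψ ((-1 : ℤ) : ZMod (M * M'))) h1
  simp only [MulChar.mul_apply, h2, h3] at h4
  apply h
  simpa [MulChar.one_apply] using h4

theorem legendreSym_neg_one_of_mod_four_eq_one {p : ℕ} [Fact p.Prime] (hp : p % 4 = 1) :
    legendreSym p (-1) = 1 := by
  rw [legendreSym.at_neg_one (by omega), ZMod.χ₄_nat_one_mod_four hp]

theorem legendreSym_neg_one_of_mod_four_eq_three {p : ℕ} [Fact p.Prime] (hp : p % 4 = 3) :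
    legendreSym p (-1) = -1 := by
  rw [legendreSym.at_neg_one (by omega), ZMod.χ₄_nat_three_mod_four hp]

theorem I_pow_mul_one_sub_neg_one_pow (n : ℕ) :
    I ^ n * (1 - (-1) ^ n) = 2 * I * (ZMod.χ₄ n : ℤ) := by
  have h : n = 4 * (n / 4) + n % 4 := (Nat.div_add_mod n 4).symm
  have h4 : n % 4 < 4 := Nat.mod_lt _ (by norm_num)
  have h1 : I ^ n = I ^ (n % 4) := by
    conv_lhs => rw [h, pow_add, pow_mul, I_pow_four, one_pow, one_mul]
  have h2 : (-1 : ℂ) ^ n = (-1) ^ (n % 4) := by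
    conv_lhs => rw [h, pow_add, pow_mul]
    norm_num
  rw [h1, h2, ZMod.χ₄_nat_mod_four]
  interval_cases n % 4
  · simp
  · have : ZMod.χ₄ ((1 : ℕ) : ZMod 4) = 1 := by decide
    rw [this]; push_cast; ring
  · have : ZMod.χ₄ ((2 : ℕ) : ZMod 4) = 0 := by decide
    rw [this]; push_cast; ring
  · have : ZMod.χ₄ ((3 : ℕ) : ZMod 4) = -1 := by decide
    rw [this, pow_succ, I_sq]; push_cast; ring

theorem one_sub_neg_one_pow_eq (n : ℕ) :
    (1 - (-1) ^ n : ℂ) = 2 * (1 : DirichletCharacter ℂ 2) (n : ZMod 2) := by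
  rcases Nat.even_or_odd n with h | h
  · have : (n : ZMod 2) = 0 := (ZMod.natCast_eq_zero_iff_even).mpr h
    rw [this, MulChar.map_zero, h.neg_one_pow]
    ring
  · have : (n : ZMod 2) = 1 := (ZMod.natCast_eq_one_iff_odd).mpr h
    rw [this, MulChar.map_one, h.neg_one_pow]
    ring

/-- With α = 1/4 the terms at a and p - a carry equal symbols, and their fractional-part differences
are both 1/2 if a < p/4 and both -1/2 otherwise. Since τ = √p, the constant is r = 2√p. -/
theorem sum_legendreSym_quarter_pos_of_mod_four_eq_one {p : ℕ} [Fact p.Prime] (hp : p % 4 = 1) :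
    0 < ∑ a ∈ Finset.Icc 1 ((p - 1) / 2), legendreSym p a * (if 4 * a < p then 1 else -1) := by
  have hpp : p.Prime := Fact.out
  have hp2 : p ≠ 2 := by omega
  have hp0 : (0 : ℝ) < p := by exact_mod_cast hpp.pos
  have hneg := legendreSym_neg_one_of_mod_four_eq_one hp
  have hneg' : legendreChar p (-1) = 1 := by
    have := legendreChar_intCast p (-1)
    rw [hneg] at this
    simpa using this
  let χ' : DirichletCharacter ℂ 4 := ZMod.χ₄.ringHomComp (Int.castRingHom ℂ)
  have : NeZero (p * 4) := ⟨mul_ne_zero hpp.ne_zero four_ne_zero⟩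
  have key := sum_legendreSym_mul_fract_sub_fract_pos hp2 (α := 1 / 4) (r := 2 * Real.sqrt p)
    (changeLevel_mul_changeLevel_sq_eq_one (legendreChar_isQuadratic p).sq_eq_one
      (χ' := χ') (ZMod.isQuadratic_χ₄.comp _).sq_eq_one)
    (changeLevel_mul_changeLevel_ne_one ?_) (by positivity) ?_ ?_
  · rw [sum_Icc_eq_sum_half (by omega)] at key
    rw [← Int.cast_pos (R := ℝ), Int.cast_sum]
    refine key.trans_eq (Finset.sum_congr rfl fun a ha => ?_)
    rw [Finset.mem_Icc] at ha
    rw [legendreSym_sub_natCast (by omega), hneg, one_mul, ← mul_add, Int.cast_mul]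
    congr 1
    have e : ((p - a : ℕ) : ℝ) / p = 1 - a / p := by
      rw [Nat.cast_sub (by omega)]; field_simp
    have ha0 : (0 : ℝ) < a / p := div_pos (by exact_mod_cast ha.1) hp0
    have ha2 : (a / p : ℝ) < 1 / 2 := by
      rw [div_lt_iff₀ hp0]
      have : (2 * a : ℝ) < p := by exact_mod_cast (by omega : 2 * a < p)
      linarith
    rw [e]
    split_ifs with h
    · have h4 : (a / p : ℝ) < 1 / 4 := by
        rw [div_lt_iff₀ hp0]
        have : (4 * a : ℝ) < p := by exact_mod_cast h
        linarith
      rw [show Int.fract (a / p + (1 / 4 + 1 / 2) : ℝ) = a / p + 3 / 4 from Int.fract_eq_iff.mpr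
          ⟨by linarith, by linarith, 0, by push_cast; ring⟩,
        show Int.fract (a / p + 1 / 4 : ℝ) = a / p + 1 / 4 from Int.fract_eq_iff.mpr
          ⟨by linarith, by linarith, 0, by push_cast; ring⟩,
        show Int.fract (1 - a / p + (1 / 4 + 1 / 2) : ℝ) = 3 / 4 - a / p from Int.fract_eq_iff.mpr
          ⟨by linarith, by linarith, 1, by push_cast; ring⟩,
        show Int.fract (1 - a / p + 1 / 4 : ℝ) = 1 / 4 - a / p from Int.fract_eq_iff.mpr
          ⟨by linarith, by linarith, 1, by push_cast; ring⟩]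
      push_cast
      ring
    · have h4 : 1 / 4 < (a / p : ℝ) := by
        rw [lt_div_iff₀ hp0]
        have : (p : ℝ) < 4 * a := by exact_mod_cast (by omega : p < 4 * a)
        linarith
      rw [show Int.fract (a / p + (1 / 4 + 1 / 2) : ℝ) = a / p - 1 / 4 from Int.fract_eq_iff.mpr
          ⟨by linarith, by linarith, 1, by push_cast; ring⟩,
        show Int.fract (a / p + 1 / 4 : ℝ) = a / p + 1 / 4 from Int.fract_eq_iff.mpr
          ⟨by linarith, by linarith, 0, by push_cast; ring⟩,
        show Int.fract (1 - a / p + (1 / 4 + 1 / 2) : ℝ) = 3 / 4 - a / p from Int.fract_eq_iff.mpr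
          ⟨by linarith, by linarith, 1, by push_cast; ring⟩,
        show Int.fract (1 - a / p + 1 / 4 : ℝ) = 5 / 4 - a / p from Int.fract_eq_iff.mpr
          ⟨by linarith, by linarith, 0, by push_cast; ring⟩]
      push_cast
      ring
  · have : χ' (-1) = -1 := by
      have h1 : ZMod.χ₄ (-1) = -1 := by decide
      change ((ZMod.χ₄ (-1) : ℤ) : ℂ) = -1
      rw [h1]; norm_num
    rw [hneg', this]
    norm_num
  · intro a _
    have h4 : p * 4 ≠ 0 := NeZero.ne _
    -- Over the denominator 4p the numerators 4a + p and 4a + 3p are odd, so neither point is an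
    -- integer.
    constructor
    · rw [show (a / p + 1 / 4 : ℝ) = ((4 * a + p : ℕ) : ℝ) / (p * 4 : ℕ) by
        push_cast; field_simp]
      refine fract_natCast_div_ne_zero h4 fun hd => ?_
      have := (Dvd.intro_left p rfl : 4 ∣ p * 4).trans hd
      omega
    · rw [show (a / p + (1 / 4 + 1 / 2) : ℝ) = ((4 * a + 3 * p : ℕ) : ℝ) / (p * 4 : ℕ) by
        push_cast; field_simp; ring]
      refine fract_natCast_div_ne_zero h4 fun hd => ?_
      have := (Dvd.intro_left p rfl : 4 ∣ p * 4).trans hd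
      omega
  · intro n
    have h1 : χ' n = ((ZMod.χ₄ n : ℤ) : ℂ) := rfl
    have h2 := exp_two_pi_fourth_mul_nat n
    rw [changeLevel_mul_changeLevel_natCast, gaussSum_legendreChar hp2, if_pos hp, h1]
    push_cast
    rw [h2, I_pow_mul_one_sub_neg_one_pow]
    ring

/-- With α = 0 the differences at a and p - a are 1/2 and -1/2 while the symbols are opposite, so
every a gets weight 1. The factor i required in the expansion comes from τ = i√p. -/
theorem sum_legendreSym_half_pos_of_mod_four_eq_three {p : ℕ} [Fact p.Prime] (hp : p % 4 = 3) :
    0 < ∑ a ∈ Finset.Icc 1 ((p - 1) / 2), legendreSym p a := by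
  have hpp : p.Prime := Fact.out
  have hp2 : p ≠ 2 := by omega
  have hp0 : (0 : ℝ) < p := by exact_mod_cast hpp.pos
  have hneg := legendreSym_neg_one_of_mod_four_eq_three hp
  have hneg' : legendreChar p (-1) = -1 := by
    have := legendreChar_intCast p (-1)
    rw [hneg] at this
    simpa using this
  have : NeZero (p * 2) := ⟨mul_ne_zero hpp.ne_zero two_ne_zero⟩
  have key := sum_legendreSym_mul_fract_sub_fract_pos hp2 (α := 0) (r := 2 * Real.sqrt p)
    (changeLevel_mul_changeLevel_sq_eq_one (legendreChar_isQuadratic p).sq_eq_one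
      (χ' := (1 : DirichletCharacter ℂ 2)) (one_pow 2))
    (changeLevel_mul_changeLevel_ne_one ?_) (by positivity) ?_ ?_
  · rw [sum_Icc_eq_sum_half (by omega)] at key
    rw [← Int.cast_pos (R := ℝ), Int.cast_sum]
    refine key.trans_eq (Finset.sum_congr rfl fun a ha => ?_)
    rw [Finset.mem_Icc] at ha
    rw [legendreSym_sub_natCast (by omega), hneg]
    have e : ((p - a : ℕ) : ℝ) / p = 1 - a / p := by
      rw [Nat.cast_sub (by omega)]; field_simp
    have ha0 : (0 : ℝ) < a / p := div_pos (by exact_mod_cast ha.1) hp0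
    have ha2 : (a / p : ℝ) < 1 / 2 := by
      rw [div_lt_iff₀ hp0]
      have : (2 * a : ℝ) < p := by exact_mod_cast (by omega : 2 * a < p)
      linarith
    rw [e,
      show Int.fract (a / p + (0 + 1 / 2) : ℝ) = a / p + 1 / 2 from Int.fract_eq_iff.mpr
        ⟨by linarith, by linarith, 0, by push_cast; ring⟩,
      show Int.fract (a / p + 0 : ℝ) = a / p from Int.fract_eq_iff.mpr
        ⟨by linarith, by linarith, 0, by push_cast; ring⟩,
      show Int.fract (1 - a / p + (0 + 1 / 2) : ℝ) = 1 / 2 - a / p from Int.fract_eq_iff.mpr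
        ⟨by linarith, by linarith, 1, by push_cast; ring⟩,
      show Int.fract (1 - a / p + 0 : ℝ) = 1 - a / p from Int.fract_eq_iff.mpr
        ⟨by linarith, by linarith, 0, by push_cast; ring⟩]
    push_cast
    ring
  · have : (1 : DirichletCharacter ℂ 2) (-1) = 1 := by
      rw [show (-1 : ZMod 2) = 1 by decide, MulChar.map_one]
    rw [hneg', this]
    norm_num
  · intro a ha
    rw [Finset.mem_Icc] at ha
    constructor
    · rw [add_zero]
      exact fract_natCast_div_ne_zero hpp.ne_zero fun hd =>
        absurd (Nat.le_of_dvd (by omega) hd) (by omega)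
    · rw [show (a / p + (0 + 1 / 2) : ℝ) = ((2 * a + p : ℕ) : ℝ) / (p * 2 : ℕ) by
        push_cast; field_simp; ring]
      refine fract_natCast_div_ne_zero (NeZero.ne _) fun hd => ?_
      have := (Dvd.intro_left p rfl : 2 ∣ p * 2).trans hd
      omega
  · intro n
    rw [changeLevel_mul_changeLevel_natCast, gaussSum_legendreChar hp2, if_neg (by omega),
      one_sub_neg_one_pow_eq]
    push_cast
    rw [mul_zero, zero_mul, exp_zero]
    ring

theorem legendreSym_two_mul_sum_pos {p : ℕ} [Fact p.Prime] (hp : p ≠ 2) :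
    0 < legendreSym p 2 *
      ∑ a ∈ Finset.Icc 1 ((p - 1) / 2), legendreSym p a * (-1 : ℤ) ^ a := by
  have hodd : p % 2 = 1 := ((Fact.out : p.Prime).eq_two_or_odd).resolve_left hp
  have h2 : ((2 : ℤ) : ZMod p) ≠ 0 := by
    rw [Int.cast_ofNat, ← Nat.cast_ofNat, Ne, ZMod.natCast_eq_zero_iff]
    intro h
    exact hp ((Nat.prime_dvd_prime_iff_eq Fact.out Nat.prime_two).mp h)
  rw [sum_legendreSym_mul_neg_one_pow hodd, ← mul_assoc, ← sq, legendreSym.sq_one p h2, one_mul]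
  rcases (by omega : p % 4 = 1 ∨ p % 4 = 3) with h | h
  · rw [legendreSym_neg_one_of_mod_four_eq_one h]
    exact sum_legendreSym_quarter_pos_of_mod_four_eq_one h
  · rw [legendreSym_neg_one_of_mod_four_eq_three h]
    simpa using sum_legendreSym_half_pos_of_mod_four_eq_three h

end Main

theorem mainTheorem5 (p : ℕ) [Fact p.Prime] (hp : p ≠ 2) :
    (((p : ℤ) ≡ 1 [ZMOD 8] ∨ (p : ℤ) ≡ -1 [ZMOD 8]) →
      0 < ∑ a ∈ Finset.Icc 1 ((p - 1) / 2), legendreSym p (a : ℤ) * (-1 : ℤ) ^ a) ∧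
    (((p : ℤ) ≡ 5 [ZMOD 8] ∨ (p : ℤ) ≡ -5 [ZMOD 8]) →
      ∑ a ∈ Finset.Icc 1 ((p - 1) / 2), legendreSym p (a : ℤ) * (-1 : ℤ) ^ a < 0) ∧
    0 < legendreSym p 2 *
      ∑ a ∈ Finset.Icc 1 ((p - 1) / 2), legendreSym p (a : ℤ) * (-1 : ℤ) ^ a := by
  have h := legendreSym_two_mul_sum_pos hp
  refine ⟨fun h8 => ?_, fun h8 => ?_, h⟩
  · have h2 : legendreSym p 2 = 1 := by
      rw [legendreSym.at_two hp, ZMod.χ₈_nat_eq_if_mod_eight]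
      simp only [Int.ModEq] at h8
      rw [if_neg (by omega), if_pos (by omega)]
    rwa [h2, one_mul] at h
  · have h2 : legendreSym p 2 = -1 := by
      rw [legendreSym.at_two hp, ZMod.χ₈_nat_eq_if_mod_eight]
      simp only [Int.ModEq] at h8
      rw [if_neg (by omega), if_neg (by omega)]
    rw [h2, neg_one_mul, neg_pos] at h
    exact h
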